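/- Let $H=\langle V,E^*\rangle$ be a simple graph with $V$ infinite. A set $L\subseteq V$ is *covering* if every $v\in V\setminus L$ has a neighbour $a\in L$ with $\{v,a\}\in E^*$. Assume that $H$ is *braided*: for each $W\subseteq V$ with $|W|<|V|$ there is a finite covering set $L\subseteq V\setminus W$. Let $n\in\mathbb N$ and let $w:V\times\mathcal P(E^*)\to\{0,1,\dots,n\}$ be a function which is 1. *non-trivial*: $w(a,\emptyset)=0$ and $w(a,E^*)=n$ for each $a\in V$; 2. *degree restricted*: there is $K\in\mathbb N$ such that for all $E\subseteq E^*$ and $a\in V$, if $a$ lies in at least $K$ members of $E$ then $w(a,E)=n$; 3. *finitely determined*: $w(a,E)=\max\{w(a,E'):E'\subseteq E,\ E'\text{ finite}\}$ for all $E\subseteq E^*$ and $a\in V$; 4. *bounded*: there are $M\in\mathbb N$ and a function $W$ assigning to each $a\in V$ and $E\subseteq E^*$ a set $W(a,E)\subseteq V$ with at most $M$ elements such that for all $a,b\in V$ and $E\subseteq E^*$: (i) $a\in W(a,E)$, and if $a\in W(b,E)$ then $W(a,E)=W(b,E)$ and $w(a,E)=w(b,E)$; (ii) if $E\subseteq E'\subseteq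 E^*$ and $w(a,E)<w(a,E')$, then some pair in $E'\setminus E$ has an endpoint in $W(a,E)$. Let $R_n$ be the property "$w(a,E)=n$ for each $a\in V$" of edge sets $E\subseteq E^*$. Then $R_n$ is monotone (it is preserved when edges of $E^*$ are added), and $R_n$ is not elusive in $H$, i.e. Alice has a winning strategy in the following game. Alice and Bob construct a transfinite sequence $\langle (E_\alpha,N_\alpha):\alpha\le\beta\rangle$ of pairs of disjoint subsets of $E^*$, starting with $E_0=N_0=\emptyset$ and taking unions $E_\alpha=\bigcup_{\zeta<\alpha}E_\zeta$, $N_\alpha=\bigcup_{\zeta<\alpha}N_\zeta$ at limit ordinals $\alpha$. The game terminates at $\beta$ as soon as either all sets $E$ with $E_\beta\subseteq E\subseteq E^*\setminus N_\beta$ have property $R_n$ or none of them has it. If it has not terminated at $\gamma$, Alice, knowing the sequence so far, picks a pair $e_\gamma\in E^*\setminus(E_\gamma\cup N_\gamma)$, and Bob decides whether $e_\gamma$ is added to $E_\gamma$ or to $N_\gamma$, which gives $(E_{\gamma+1},N_{\gamma+1})$. Bob wins if $E_\beta\cup N_\beta=E^*$ at termination; otherwise Alice wins. -/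

import Mathlib

universe u

namespace EdgeGame

variable {V : Type u}

/-- A set `L` of vertices is covering in `H` if every vertex outside `L` has a neighbour in `L`. -/
def IsCovering (H : SimpleGraph V) (L : Set V) : Prop :=
  ∀ v, v ∉ L → ∃ a ∈ L, H.Adj v a

/-- `H` is braided: every set `W` of fewer than `|V|` vertices is avoided by some finite
covering set. -/
def IsBraided (H : SimpleGraph V) : Prop :=
  ∀ W : Set V, Cardinal.mk W < Cardinal.mk V →
    ∃ L : Set V, L.Finite ∧ L ⊆ Wᶜ ∧ IsCovering H L

/-! Subsets `E` of the set of allowed edges are terms of `Set H.edgeSet`; such an `E` is also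
identified with the `H`-graph with edge set `E`, and a property of `H`-graphs is a predicate
on `Set H.edgeSet`. -/

/-- An `H`-pregraph: disjoint sets of edges and of nonedges among the allowed pairs. -/
structure Pregraph (H : SimpleGraph V) where
  edges : Set H.edgeSet
  nonedges : Set H.edgeSet
  disj : Disjoint edges nonedges

namespace Pregraph

variable {H : SimpleGraph V}

/-- The set of determined pairs. -/
def determined (G : Pregraph H) : Set H.edgeSet := G.edges ∪ G.nonedges

/-- The set of undetermined pairs. -/
def undetermined (G : Pregraph H) : Set H.edgeSet := G.determinedᶜ

/-- `G₂` extends `G₁`. -/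
def Extends (G₂ G₁ : Pregraph H) : Prop :=
  G₁.edges ⊆ G₂.edges ∧ G₁.nonedges ⊆ G₂.nonedges

/-- The `H`-graph with edge set `E` extends the pregraph `G`. -/
def GraphExtends (E : Set H.edgeSet) (G : Pregraph H) : Prop :=
  G.edges ⊆ E ∧ G.nonedges ⊆ Eᶜ

/-- The game for the property `R` has terminated at `G`: every `H`-graph extending `G` has `R`,
or no `H`-graph extending `G` has `R`. -/
def Decides (G : Pregraph H) (R : Set H.edgeSet → Prop) : Prop :=
  (∀ E, GraphExtends E G → R E) ∨ (∀ E, GraphExtends E G → ¬ R E)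

end Pregraph

/-- A strategy of Alice: after turn `γ`, knowing the whole history `⟨G_α : α ≤ γ⟩`, she picks an
undetermined pair of `G_γ` whenever the game has not terminated. -/
structure AliceStrategy (H : SimpleGraph V) (R : Set H.edgeSet → Prop) where
  pick : (γ : Ordinal.{u}) → (Set.Iic γ → Pregraph H) → H.edgeSet
  legal : ∀ (γ : Ordinal.{u}) (h : Set.Iic γ → Pregraph H),
    ¬ (h ⟨γ, le_refl γ⟩).Decides R → pick γ h ∈ (h ⟨γ, le_refl γ⟩).undetermined

/-- `⟨G_α : α ≤ β⟩` is a completed play of the game in which Alice follows the strategy `σ` and the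
answers of Bob are arbitrary. Only the values of `G` at ordinals `α ≤ β` matter. -/
structure IsPlay {H : SimpleGraph V} {R : Set H.edgeSet → Prop} (σ : AliceStrategy H R)
    (β : Ordinal.{u}) (G : Ordinal.{u} → Pregraph H) : Prop where
  zero_edges : (G 0).edges = ∅
  zero_nonedges : (G 0).nonedges = ∅
  limit_edges : ∀ α ≤ β, Order.IsSuccLimit α → (G α).edges = ⋃ ζ < α, (G ζ).edges
  limit_nonedges : ∀ α ≤ β, Order.IsSuccLimit α → (G α).nonedges = ⋃ ζ < α, (G ζ).nonedges
  not_terminated : ∀ γ < β, ¬ (G γ).Decides R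
  succ_extends : ∀ γ < β, (G (Order.succ γ)).Extends (G γ)
  succ_determined : ∀ γ < β, (G (Order.succ γ)).determined =
    (G γ).determined ∪ {σ.pick γ (fun α => G α.1)}
  terminated : (G β).Decides R

/-- Bob wins a play ending in `G_β` iff all pairs of `H` are determined in `G_β`; so `σ` is a winning
strategy iff every play following it ends with `G_β` having an undetermined pair.
(A play cannot go on through all ordinals, since each turn determines a new pair.) -/
def AliceStrategy.IsWinning {H : SimpleGraph V} {R : Set H.edgeSet → Prop}
    (σ : AliceStrategy H R) : Prop :=
  ∀ (β : Ordinal.{u}) (G : Ordinal.{u} → Pregraph H), IsPlay σ β G →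
    (G β).determined ≠ Set.univ

/-- `R` is elusive in `H`: Alice has no winning strategy. -/
def IsElusive (H : SimpleGraph V) (R : Set H.edgeSet → Prop) : Prop :=
  ¬ ∃ σ : AliceStrategy H R, σ.IsWinning

variable {H : SimpleGraph V} {n : ℕ}

/-- The degree of the vertex `a` in the `H`-graph with edge set `E`. -/
noncomputable def degree (E : Set H.edgeSet) (a : V) : ℕ∞ :=
  {e ∈ E | a ∈ (e : Sym2 V)}.encard

/-- Non-trivial. -/
def IsNontrivial (w : V → Set H.edgeSet → Fin (n + 1)) : Prop :=
  ∀ a, w a ∅ = 0 ∧ w a Set.univ = Fin.last n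

/-- Degree restricted. -/
def IsDegreeRestricted (w : V → Set H.edgeSet → Fin (n + 1)) : Prop :=
  ∃ K : ℕ, ∀ (E : Set H.edgeSet) (a : V), (K : ℕ∞) ≤ degree E a → w a E = Fin.last n

/-- Finitely determined: `w a E` is the maximum of `w a E'` over the finite `E' ⊆ E`. -/
def IsFinitelyDetermined (w : V → Set H.edgeSet → Fin (n + 1)) : Prop :=
  ∀ (E : Set H.edgeSet) (a : V),
    IsGreatest {k | ∃ E' : Set H.edgeSet, E' ⊆ E ∧ E'.Finite ∧ w a E' = k} (w a E)

/-- Bounded. The last clause says that some pair in `E' \ E` has an endpoint in `W a E`. -/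
def IsBounded (w : V → Set H.edgeSet → Fin (n + 1)) : Prop :=
  ∃ (M : ℕ) (W : V → Set H.edgeSet → Finset V),
    (∀ a E, (W a E).card ≤ M) ∧
    (∀ a E, a ∈ W a E) ∧
    (∀ a b E, a ∈ W b E → W a E = W b E ∧ w a E = w b E) ∧
    (∀ a E E', E ⊆ E' → w a E < w a E' →
      ∃ e ∈ E' \ E, ∃ x ∈ W a E, x ∈ (e : Sym2 V))

end EdgeGame

/-!
Call a vertex `a` satisfied by `E` when `w a E = n`, so that `R_n` says that all vertices are
satisfied, and call a pair alive while it is undetermined. Alice has won as soon as the game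
terminates with a pair alive. This happens in two ways.

* If `a` is unsatisfied and no alive pair meets its block `W a E`, boundedness shows that `a` stays
  unsatisfied for ever: no extension has `R_n` (`IsBlockSystem.decides`).
* If some alive pair has only satisfied endpoints, Alice asks about all the others. Afterwards
  either all vertices are satisfied, or the block of an unsatisfied one meets no alive pair
  (`wins_of_sat_edge`).

Hence, whenever Alice asks about all alive pairs that meet the block of an unsatisfied vertex and
some pair disjoint from the block is kept alive, Bob has to add one of them to the graph. If the
pairs she asks about all meet a fixed finite set `Y`, then by the degree restriction at most
`|Y| * K` positive answers are possible before a vertex of `Y` is satisfied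
(`exists_sat_of_card_le`). So she can force a satisfied vertex in `Y`, provided that all alive pairs
meet `Y` and that each vertex of `Y` lies in infinitely many of them.

* With infinitely many unsatisfied vertices, she uses blocks disjoint from `Y`; only finitely many
  pairs meet both such a block and `Y`, so this takes finitely many questions, and none of them is
  about a pair inside `Y` (`wins_of_infinite_unsat`).
* With finitely many unsatisfied vertices, she first thins out the alive pairs so that countably
  many remain and each joins some `y ∈ Y` to a satisfied vertex outside `Y`. As `|Y| > M`, the block
  of `y₀ ∈ Y` misses some `y₁ ∈ Y`. She asks about the pairs meeting the block of `y₀` in order type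
  `ω`, stopping at the first positive answer: only finitely many pairs are spent then, so the
  situation is unchanged apart from the new edge. Once a vertex of `Y` is satisfied, any alive pair
  at it has both ends satisfied (`wins_of_countable_stars`).

These are combined in `wins_of_infinite_stars`: Alice either wins outright or obtains a satisfied
vertex of `Y` at a finite cost. As `H` is braided, disjoint finite covering sets can be collected
into a finite `Y` in which every vertex of `H` has more than `M` neighbours, and all degrees of `H`
are infinite. Alice determines all pairs that do not meet `Y` and obtains a satisfied `z ∈ Y`. Then
she determines all pairs that do not meet the set `Y'` of neighbours of `z` in `Y`, and obtains a
satisfied `y ∈ Y'`. The pair `s(z, y)` is alive throughout, and both its ends are satisfied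
(`wins_of_isBraided`).

Strategies are composed by `Wins.of_reach`: it is enough to reach a position in which Alice can win.
-/

namespace EdgeGame

variable {V : Type u} {H : SimpleGraph V} {R : Set H.edgeSet → Prop}

/-! ### Extensions of pregraphs -/

namespace Pregraph

theorem ext_sets {P Q : Pregraph H} (h₁ : P.edges = Q.edges) (h₂ : P.nonedges = Q.nonedges) :
    P = Q := by
  cases P; cases Q; simp_all

theorem mem_undetermined {P : Pregraph H} {e : H.edgeSet} :
    e ∈ P.undetermined ↔ e ∉ P.edges ∧ e ∉ P.nonedges := by
  simp [undetermined, determined]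

theorem Extends.refl (P : Pregraph H) : P.Extends P := ⟨subset_rfl, subset_rfl⟩

theorem Extends.trans {P Q S : Pregraph H} (h₁ : S.Extends Q) (h₂ : Q.Extends P) :
    S.Extends P := ⟨h₂.1.trans h₁.1, h₂.2.trans h₁.2⟩

theorem Extends.determined_subset {P Q : Pregraph H} (h : Q.Extends P) :
    P.determined ⊆ Q.determined := Set.union_subset_union h.1 h.2

theorem Extends.undetermined_subset {P Q : Pregraph H} (h : Q.Extends P) :
    Q.undetermined ⊆ P.undetermined := Set.compl_subset_compl.2 h.determined_subset

theorem Extends.edges_subset {P Q : Pregraph H} {D : Set H.edgeSet} (h : Q.Extends P)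
    (hQ : Q.determined = P.determined ∪ D) : Q.edges ⊆ P.edges ∪ D := by
  intro e he
  have h1 : e ∈ P.determined ∪ D := hQ ▸ Or.inl he
  rcases h1 with (h1 | h1) | h1
  · exact Or.inl h1
  · exact absurd (h.2 h1) (Set.disjoint_left.1 Q.disj he)
  · exact Or.inr h1

theorem Extends.nonedges_subset {P Q : Pregraph H} {D : Set H.edgeSet} (h : Q.Extends P)
    (hQ : Q.determined = P.determined ∪ D) : Q.nonedges ⊆ P.nonedges ∪ D := by
  intro e he
  have h1 : e ∈ P.determined ∪ D := hQ ▸ Or.inr he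
  rcases h1 with (h1 | h1) | h1
  · exact absurd he (Set.disjoint_left.1 Q.disj (h.1 h1))
  · exact Or.inl h1
  · exact Or.inr h1

theorem undetermined_eq_diff {P Q : Pregraph H} {D : Set H.edgeSet}
    (hQ : Q.determined = P.determined ∪ D) : Q.undetermined = P.undetermined \ D := by
  rw [undetermined, hQ, Set.compl_union]; rfl

/-- A pregraph without undetermined pairs is extended only by the graph of its edges. -/
theorem undetermined_nonempty {P : Pregraph H} (h : ¬ P.Decides R) :
    P.undetermined.Nonempty := by
  by_contra hne
  have hall : ∀ e, e ∈ P.edges ∨ e ∈ P.nonedges := fun e => by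
    by_contra hc
    exact hne ⟨e, hc⟩
  have huniq : ∀ E, GraphExtends E P → E = P.edges := fun E hE =>
    Set.Subset.antisymm
      (fun e he => (hall e).resolve_right fun hn => hE.2 hn he) hE.1
  apply h
  by_cases hR : R P.edges
  · exact Or.inl fun E hE => huniq E hE ▸ hR
  · exact Or.inr fun E hE => huniq E hE ▸ hR

end Pregraph

open Pregraph

/-! ### Winning positions and composition of strategies -/

/-- A completed play of the game that starts from the position `P` instead of the empty one.
Times are counted from `0` again. -/
structure IsPlayFrom (σ : AliceStrategy H R) (P : Pregraph H)
    (β : Ordinal.{u}) (G : Ordinal.{u} → Pregraph H) : Prop where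
  start : G 0 = P
  limit_edges : ∀ α ≤ β, Order.IsSuccLimit α → (G α).edges = ⋃ ζ < α, (G ζ).edges
  limit_nonedges : ∀ α ≤ β, Order.IsSuccLimit α → (G α).nonedges = ⋃ ζ < α, (G ζ).nonedges
  not_terminated : ∀ γ < β, ¬ (G γ).Decides R
  succ_extends : ∀ γ < β, (G (Order.succ γ)).Extends (G γ)
  succ_determined : ∀ γ < β, (G (Order.succ γ)).determined =
    (G γ).determined ∪ {σ.pick γ (fun α => G α.1)}
  terminated : (G β).Decides R

theorem IsPlayFrom.extends_of_le {σ : AliceStrategy H R} {P : Pregraph H} {β : Ordinal.{u}}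
    {G : Ordinal.{u} → Pregraph H} (h : IsPlayFrom σ P β G) {δ γ : Ordinal.{u}} (hδ : δ ≤ γ)
    (hγ : γ ≤ β) : (G γ).Extends (G δ) := by
  induction γ using Ordinal.limitRecOn with
  | zero => rw [nonpos_iff_eq_zero.1 hδ]; exact Extends.refl _
  | add_one γ ih =>
    rw [← Order.succ_eq_add_one] at hδ hγ ⊢
    rcases hδ.eq_or_lt with rfl | hlt
    · exact Extends.refl _
    · have hγ' : γ < β := (Order.lt_succ γ).trans_le hγ
      exact (h.succ_extends γ hγ').trans (ih (Order.lt_succ_iff.1 hlt) hγ'.le)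
  | limit γ hlim ih =>
    rcases hδ.eq_or_lt with rfl | hlt
    · exact Extends.refl _
    · refine ⟨?_, ?_⟩
      · rw [h.limit_edges γ hγ hlim]
        exact Set.subset_biUnion_of_mem (u := fun ζ => (G ζ).edges) hlt
      · rw [h.limit_nonedges γ hγ hlim]
        exact Set.subset_biUnion_of_mem (u := fun ζ => (G ζ).nonedges) hlt

/-- Alice has a strategy that wins every play starting from the position `P`. -/
def Wins (R : Set H.edgeSet → Prop) (P : Pregraph H) : Prop :=
  ∃ σ : AliceStrategy H R, ∀ (β : Ordinal.{u}) (G : Ordinal.{u} → Pregraph H),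
    IsPlayFrom σ P β G → (G β).determined ≠ Set.univ

theorem not_isElusive_of_wins {P : Pregraph H} (h₁ : P.edges = ∅) (h₂ : P.nonedges = ∅)
    (h : Wins R P) : ¬ IsElusive H R := by
  obtain ⟨σ, hσ⟩ := h
  refine not_not.2 ⟨σ, fun β G hG => hσ β G ?_⟩
  exact ⟨ext_sets (hG.zero_edges.trans h₁.symm) (hG.zero_nonedges.trans h₂.symm), hG.limit_edges,
    hG.limit_nonedges, hG.not_terminated, hG.succ_extends, hG.succ_determined, hG.terminated⟩

open Classical in
/-- The history `h` as a function on all ordinals; the values above `γ` are irrelevant. -/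
noncomputable def extendHistory {γ : Ordinal.{u}} (h : Set.Iic γ → Pregraph H) :
    Ordinal.{u} → Pregraph H :=
  fun α => if hα : α ≤ γ then h ⟨α, hα⟩ else h ⟨γ, le_refl γ⟩

theorem extendHistory_of_le {γ α : Ordinal.{u}} (h : Set.Iic γ → Pregraph H) (hα : α ≤ γ) :
    extendHistory h α = h ⟨α, hα⟩ := dif_pos hα

open Classical in
/-- Follow `σ` until a position in which Alice can win is reached, and from then on follow a
strategy that wins from the first such position. -/
noncomputable def AliceStrategy.switch (σ : AliceStrategy H R) : AliceStrategy H R where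
  pick γ h :=
    if hx : ∃ δ, δ ≤ γ ∧ Wins R (extendHistory h δ) then
      let τ := sInf {δ | δ ≤ γ ∧ Wins R (extendHistory h δ)}
      (csInf_mem (s := {δ | δ ≤ γ ∧ Wins R (extendHistory h δ)}) hx).2.choose.pick (γ - τ)
        (fun α => extendHistory h (τ + α.1))
    else σ.pick γ h
  legal γ h hd := by
    dsimp only
    split_ifs with hx
    · set τ := sInf {δ | δ ≤ γ ∧ Wins R (extendHistory h δ)}
      have hmem := csInf_mem (s := {δ | δ ≤ γ ∧ Wins R (extendHistory h δ)}) hx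
      have hle : τ ≤ γ := hmem.1
      have hγ : extendHistory h (τ + (γ - τ)) = h ⟨γ, le_refl γ⟩ := by
        rw [Ordinal.add_sub_cancel_of_le hle, extendHistory_of_le h le_rfl]
      have := hmem.2.choose.legal (γ - τ) (fun α => extendHistory h (τ + α.1))
      simp only [hγ] at this
      exact this hd
    · exact σ.legal γ h hd

/-- It is enough to reach a winning position in every play that would otherwise be lost. The
winning strategy follows `σ` up to the first winning position; the rest of the play, with its times
shifted, is then a play from that position. -/
theorem Wins.of_reach {P : Pregraph H} (σ : AliceStrategy H R)
    (h : ∀ (β : Ordinal.{u}) (G : Ordinal.{u} → Pregraph H), IsPlayFrom σ P β G →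
      (G β).determined = Set.univ → ∃ γ ≤ β, Wins R (G γ)) : Wins R P := by
  refine ⟨σ.switch, fun β G hG hdet => ?_⟩
  have hext : ∀ γ α, α ≤ γ → extendHistory (fun α : Set.Iic γ => G α.1) α = G α :=
    fun γ α hα => extendHistory_of_le _ hα
  by_cases hx : ∃ δ, δ ≤ β ∧ Wins R (G δ)
  · set τ := sInf {δ | δ ≤ β ∧ Wins R (G δ)}
    have hmem : τ ≤ β ∧ Wins R (G τ) := csInf_mem (s := {δ | δ ≤ β ∧ Wins R (G δ)}) hx
    have hset : ∀ γ, τ ≤ γ → γ ≤ β →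
        sInf {δ | δ ≤ γ ∧ Wins R (extendHistory (fun α : Set.Iic γ => G α.1) δ)} = τ := by
      intro γ h1 h2
      apply le_antisymm
      · exact csInf_le' ⟨h1, (hext γ τ h1).symm ▸ hmem.2⟩
      · refine le_csInf ⟨τ, h1, (hext γ τ h1).symm ▸ hmem.2⟩ fun δ hδ => ?_
        exact csInf_le' ⟨hδ.1.trans h2, hext γ δ hδ.1 ▸ hδ.2⟩
    have hpick : ∀ γ, τ ≤ γ → γ ≤ β → σ.switch.pick γ (fun α => G α.1) =
        hmem.2.choose.pick (γ - τ) (fun α => G (τ + α.1)) := by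
      intro γ h1 h2
      have hx' : ∃ δ, δ ≤ γ ∧ Wins R (extendHistory (fun α : Set.Iic γ => G α.1) δ) :=
        ⟨τ, h1, (hext γ τ h1).symm ▸ hmem.2⟩
      -- The first winning position is computed from the history up to `γ`, so its time `ρ` and the
      -- proof that it is winning are only propositionally equal to those of the whole play.
      have key : ∀ (ρ : Ordinal.{u}) (Q : Pregraph H) (hρ : ρ = τ) (hQ : Q = G τ)
          (hw : Wins R Q), hw.choose.pick (γ - ρ)
            (fun α => extendHistory (fun α : Set.Iic γ => G α.1) (ρ + α.1)) =
          hmem.2.choose.pick (γ - τ) (fun α => G (τ + α.1)) := by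
        rintro ρ Q rfl rfl hw
        congr 1
        funext α
        refine hext γ _ ?_
        calc _ ≤ _ + (γ - _) := by gcongr; exact α.2
          _ = γ := Ordinal.add_sub_cancel_of_le h1
      refine (dif_pos hx').trans ?_
      exact key _ _ (hset γ h1 h2) ((hext γ _ (by rw [hset γ h1 h2]; exact h1)).trans
        (congrArg G (hset γ h1 h2))) _
    have hadd : τ + (β - τ) = β := Ordinal.add_sub_cancel_of_le hmem.1
    have hle : ∀ α, α ≤ β - τ → τ + α ≤ β := fun α hα => by
      rw [← hadd]; gcongr
    have hlt : ∀ α, α < β - τ → τ + α < β := fun α hα => by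
      rw [← hadd]; gcongr
    have hsucc : ∀ γ, τ + Order.succ γ = Order.succ (τ + γ) := fun γ => by
      rw [Order.succ_eq_add_one, Order.succ_eq_add_one, add_assoc]
    have hplay : IsPlayFrom hmem.2.choose (G τ) (β - τ) (fun α => G (τ + α)) := by
      refine ⟨by simp, ?_, ?_, fun γ hγ => hG.not_terminated _ (hlt γ hγ), ?_, ?_, ?_⟩
      · intro α hα hlim
        rw [hG.limit_edges _ (hle α hα) (Ordinal.isSuccLimit_add τ hlim)]
        refine Set.Subset.antisymm (Set.iUnion₂_subset fun ζ hζ => ?_)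
          (Set.iUnion₂_subset fun ζ hζ => Set.subset_biUnion_of_mem (u := fun ζ => (G ζ).edges)
            (show τ + ζ < τ + α by gcongr))
        -- The times `ζ < τ` before the shifted play are absorbed, as `ζ ≤ τ + (ζ - τ)`.
        have h1 : τ + (ζ - τ) ≤ β := (add_le_add_right
          (Ordinal.sub_le.2 hζ.le) τ).trans (hle α hα)
        refine (IsPlayFrom.extends_of_le hG (Ordinal.le_add_sub ζ τ) h1).1.trans
          (Set.subset_biUnion_of_mem (u := fun ζ => (G (τ + ζ)).edges) ?_)
        rcases le_or_gt τ ζ with h2 | h2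
        · exact Ordinal.sub_lt_of_le h2 |>.2 hζ
        · rw [Ordinal.sub_eq_zero_iff_le.2 h2.le]; exact hlim.bot_lt
      · intro α hα hlim
        rw [hG.limit_nonedges _ (hle α hα) (Ordinal.isSuccLimit_add τ hlim)]
        refine Set.Subset.antisymm (Set.iUnion₂_subset fun ζ hζ => ?_)
          (Set.iUnion₂_subset fun ζ hζ => Set.subset_biUnion_of_mem (u := fun ζ => (G ζ).nonedges)
            (show τ + ζ < τ + α by gcongr))
        have h1 : τ + (ζ - τ) ≤ β := (add_le_add_right
          (Ordinal.sub_le.2 hζ.le) τ).trans (hle α hα)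
        refine (IsPlayFrom.extends_of_le hG (Ordinal.le_add_sub ζ τ) h1).2.trans
          (Set.subset_biUnion_of_mem (u := fun ζ => (G (τ + ζ)).nonedges) ?_)
        rcases le_or_gt τ ζ with h2 | h2
        · exact Ordinal.sub_lt_of_le h2 |>.2 hζ
        · rw [Ordinal.sub_eq_zero_iff_le.2 h2.le]; exact hlim.bot_lt
      · intro γ hγ
        rw [hsucc]
        exact hG.succ_extends _ (hlt γ hγ)
      · intro γ hγ
        rw [hsucc, hG.succ_determined _ (hlt γ hγ),
          hpick _ (le_add_of_nonneg_right zero_le) (hlt γ hγ).le, Ordinal.add_sub_cancel]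
      · rw [hadd]; exact hG.terminated
    refine hmem.2.choose_spec _ _ hplay ?_
    rw [hadd]; exact hdet
  · have hx' : ∀ γ ≤ β, ¬ ∃ δ, δ ≤ γ ∧
        Wins R (extendHistory (fun α : Set.Iic γ => G α.1) δ) := by
      rintro γ hγ ⟨δ, h1, h2⟩
      exact hx ⟨δ, h1.trans hγ, hext γ δ h1 ▸ h2⟩
    have hplay : IsPlayFrom σ P β G := by
      refine ⟨hG.start, hG.limit_edges, hG.limit_nonedges, hG.not_terminated, hG.succ_extends,
        fun γ hγ => ?_, hG.terminated⟩
      rw [hG.succ_determined γ hγ]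
      congr 2
      exact dif_neg (hx' γ hγ.le)
    exact hx (h β G hplay hdet)

/-! ### Asking about a set of pairs -/

theorem Pregraph.Extends.yes_or_no {P Q : Pregraph H} {e : H.edgeSet} (h : Q.Extends P)
    (hQ : Q.determined = P.determined ∪ {e}) :
    (Q.edges = insert e P.edges ∧ Q.nonedges = P.nonedges) ∨
      (Q.edges = P.edges ∧ Q.nonedges = insert e P.nonedges) := by
  have h₁ := h.edges_subset hQ
  have h₂ := h.nonedges_subset hQ
  rw [Set.union_singleton] at h₁ h₂
  have he : e ∈ Q.edges ∪ Q.nonedges := hQ.superset (Or.inr rfl)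
  rcases he with he | he
  · refine Or.inl ⟨h₁.antisymm (Set.insert_subset he h.1), Set.Subset.antisymm (fun x hx => ?_) h.2⟩
    rcases h₂ hx with rfl | hx'
    · exact absurd hx (Set.disjoint_left.1 Q.disj he)
    · exact hx'
  · refine Or.inr ⟨Set.Subset.antisymm (fun x hx => ?_) h.1, h₂.antisymm (Set.insert_subset he h.2)⟩
    rcases h₁ hx with rfl | hx'
    · exact absurd he (Set.disjoint_left.1 Q.disj hx)
    · exact hx'

open Classical in
/-- The strategy that asks, in the position `Q`, about a pair in `f Q` as long as there is an
undetermined one, and about any undetermined pair otherwise. The pair `e₀` is a junk value for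
positions without undetermined pairs. -/
noncomputable def AliceStrategy.prefer (e₀ : H.edgeSet) (f : Pregraph H → Set H.edgeSet) :
    AliceStrategy H R where
  pick γ h :=
    if hf : (f (h ⟨γ, le_refl γ⟩) ∩ (h ⟨γ, le_refl γ⟩).undetermined).Nonempty then hf.some
    else if hu : (h ⟨γ, le_refl γ⟩).undetermined.Nonempty then hu.some else e₀
  legal γ h hd := by
    split_ifs with hf hu
    · exact hf.some_mem.2
    · exact hu.some_mem
    · exact absurd (undetermined_nonempty hd) hu

theorem AliceStrategy.prefer_pick_mem (e₀ : H.edgeSet) (f : Pregraph H → Set H.edgeSet)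
    (γ : Ordinal.{u}) (G : Ordinal.{u} → Pregraph H)
    (hf : (f (G γ) ∩ (G γ).undetermined).Nonempty) :
    (AliceStrategy.prefer (R := R) e₀ f).pick γ (fun α => G α.1) ∈
      f (G γ) ∩ (G γ).undetermined := by
  have h : (AliceStrategy.prefer (R := R) e₀ f).pick γ (fun α => G α.1) = hf.some := dif_pos hf
  rw [h]
  exact hf.some_mem

/-- If the game has terminated with a pair undetermined, then Alice has won. -/
theorem wins_of_decides {P : Pregraph H} (hP : P.Decides R) (hu : P.undetermined.Nonempty) :
    Wins R P := by
  obtain ⟨e₀, he₀⟩ := hu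
  refine ⟨AliceStrategy.prefer e₀ fun _ => ∅, fun β G hG hdet => ?_⟩
  have hβ : β = 0 := by
    by_contra hβ
    exact hG.not_terminated 0 (pos_iff_ne_zero.2 hβ) (hG.start.symm ▸ hP)
  subst hβ
  rw [hG.start] at hdet
  exact he₀ (hdet ▸ Set.mem_univ e₀)

/-- Alice may ask about all the pairs in `D`, in some order, before she goes on. If the game
terminates before they are all determined, she has won. -/
theorem Wins.ask_all {P : Pregraph H} (D : Set H.edgeSet)
    (h : ∀ Q : Pregraph H, Q.Extends P → Q.determined = P.determined ∪ D → Wins R Q) :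
    Wins R P := by
  rcases D.eq_empty_or_nonempty with rfl | ⟨e₀, -⟩
  · exact h P (Extends.refl P) (by simp)
  refine Wins.of_reach (AliceStrategy.prefer e₀ fun _ => D) fun β G hG hdet => ?_
  have hβ : D ⊆ (G β).determined := hdet ▸ Set.subset_univ D
  set τ := sInf {γ | D ⊆ (G γ).determined}
  have hτD : D ⊆ (G τ).determined := csInf_mem (s := {γ | D ⊆ (G γ).determined}) ⟨β, hβ⟩
  have hτβ : τ ≤ β := csInf_le' hβ
  -- Before the first time `τ` at which `D` is determined, only pairs of `D` are asked.
  have key : ∀ γ ≤ τ, (G γ).determined ⊆ P.determined ∪ D := by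
    intro γ
    induction γ using Ordinal.limitRecOn with
    | zero => intro _; rw [hG.start]; exact Set.subset_union_left
    | add_one γ ih =>
      rw [← Order.succ_eq_add_one]
      intro hγ
      have hγτ : γ < τ := (Order.lt_succ γ).trans_le hγ
      have hne : (D ∩ (G γ).undetermined).Nonempty := by
        obtain ⟨e, he, he'⟩ := Set.not_subset.1 (notMem_of_lt_csInf' hγτ)
        exact ⟨e, he, he'⟩
      rw [hG.succ_determined γ (hγτ.trans_le hτβ)]
      refine Set.union_subset (ih hγτ.le) (Set.singleton_subset_iff.2 (Or.inr ?_))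
      exact (AliceStrategy.prefer_pick_mem e₀ (fun _ => D) γ G hne).1
    | limit γ hlim ih =>
      intro hγ
      rw [determined, hG.limit_edges γ (hγ.trans hτβ) hlim,
        hG.limit_nonedges γ (hγ.trans hτβ) hlim]
      refine Set.union_subset (Set.iUnion₂_subset fun ζ hζ => ?_)
        (Set.iUnion₂_subset fun ζ hζ => ?_)
      · exact Set.subset_union_left.trans (ih ζ hζ (hζ.le.trans hγ))
      · exact Set.subset_union_right.trans (ih ζ hζ (hζ.le.trans hγ))
  have hext : (G τ).Extends P := hG.start ▸ hG.extends_of_le zero_le hτβ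
  exact ⟨τ, hτβ, h _ hext ((key τ le_rfl).antisymm
    (Set.union_subset hext.determined_subset hτD))⟩

/-- Alice may ask about the pairs `e 0, e 1, …` until the first positive answer. If there is none,
the game goes on at time `ω`, after all of them. -/
theorem Wins.ask_until_yes {P : Pregraph H} (e : ℕ → H.edgeSet) (he : Function.Injective e)
    (hu : ∀ i, e i ∈ P.undetermined)
    (hyes : ∀ (i : ℕ) (Q : Pregraph H), Q.edges = insert (e i) P.edges →
      Q.nonedges = P.nonedges ∪ e '' Set.Iio i → Wins R Q)
    (hno : ∀ Q : Pregraph H, Q.edges = P.edges → Q.nonedges = P.nonedges ∪ Set.range e →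
      Wins R Q) : Wins R P := by
  -- At each time the only undetermined member of `f Q` is the first `e i` not yet asked.
  let f : Pregraph H → Set H.edgeSet := fun Q => {x | ∃ i, x = e i ∧ ∀ j < i, e j ∉ Q.undetermined}
  refine Wins.of_reach (AliceStrategy.prefer (e 0) f) fun β G hG hdet => ?_
  by_contra hcon
  push Not at hcon
  have key : ∀ i : ℕ, (i : Ordinal.{u}) ≤ β ∧ (G i).edges = P.edges ∧
      (G i).nonedges = P.nonedges ∪ e '' Set.Iio i := by
    intro i
    induction i with
    | zero => simp [hG.start]
    | succ i ih =>
      obtain ⟨hi, hE, hN⟩ := ih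
      have hmem : ∀ j, e j ∈ (G i).undetermined ↔ i ≤ j := by
        intro j
        have hj := mem_undetermined.1 (hu j)
        rw [mem_undetermined, hE, hN, Set.mem_union, he.mem_set_image, Set.mem_Iio]
        simp [hj]
      have hiβ : (i : Ordinal.{u}) < β := by
        refine hi.lt_of_ne fun h => (hmem i).2 le_rfl ?_
        rw [h, hdet]
        exact Set.mem_univ _
      have hpick := AliceStrategy.prefer_pick_mem (R := R) (e 0) f i G
        ⟨e i, ⟨i, rfl, fun j hj h => absurd ((hmem j).1 h) hj.not_ge⟩, (hmem i).2 le_rfl⟩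
      obtain ⟨⟨j, hj, hlt⟩, hju⟩ := hpick
      have hij : j = i := by
        rw [hj, hmem] at hju
        exact hju.antisymm' (not_lt.1 fun h => hlt i h ((hmem i).2 le_rfl))
      rw [hij] at hj
      have hdet' := hG.succ_determined i hiβ
      rw [hj] at hdet'
      have hsucc : Order.succ (i : Ordinal.{u}) = ((i + 1 : ℕ) : Ordinal.{u}) := by
        rw [Order.succ_eq_add_one]; push_cast; rfl
      have hext := hG.succ_extends i hiβ
      rw [hsucc] at hdet' hext
      have hiβ' : ((i + 1 : ℕ) : Ordinal.{u}) ≤ β := hsucc ▸ Order.succ_le_of_lt hiβ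
      rcases hext.yes_or_no hdet' with ⟨h1, h2⟩ | ⟨h1, h2⟩
      · exact absurd (hyes i _ (hE ▸ h1) (hN ▸ h2)) (hcon _ hiβ')
      · refine ⟨hiβ', h1.trans hE, ?_⟩
        rw [h2, hN, ← Set.union_insert, ← Set.image_insert_eq]
        congr 2
        ext j
        simp only [Set.mem_insert_iff, Set.mem_Iio]
        omega
  have hω : Ordinal.omega0.{u} ≤ β := Ordinal.omega0_le.2 fun i => (key i).1
  refine hcon _ hω (hno _ ?_ ?_)
  · rw [hG.limit_edges _ hω Ordinal.isSuccLimit_omega0]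
    refine Set.Subset.antisymm (Set.iUnion₂_subset fun ζ hζ => ?_) ?_
    · obtain ⟨i, rfl⟩ := Ordinal.lt_omega0.1 hζ
      exact (key i).2.1.subset
    · rw [← (key 0).2.1]
      exact Set.subset_biUnion_of_mem (u := fun ζ => (G ζ).edges) (Ordinal.natCast_lt_omega0 0)
  · rw [hG.limit_nonedges _ hω Ordinal.isSuccLimit_omega0]
    refine Set.Subset.antisymm (Set.iUnion₂_subset fun ζ hζ => ?_) ?_
    · obtain ⟨i, rfl⟩ := Ordinal.lt_omega0.1 hζ
      rw [(key i).2.2]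
      exact Set.union_subset_union_right _ (Set.image_subset_range _ _)
    · have hsub : ∀ i : ℕ, P.nonedges ∪ e '' Set.Iio i ⊆
          ⋃ ζ < Ordinal.omega0.{u}, (G ζ).nonedges := fun i => by
        rw [← (key i).2.2]
        exact Set.subset_biUnion_of_mem (u := fun ζ => (G ζ).nonedges) (Ordinal.natCast_lt_omega0 i)
      refine Set.union_subset (Set.subset_union_left.trans (hsub 0)) ?_
      rintro _ ⟨i, rfl⟩
      exact hsub (i + 1) (Or.inr ⟨i, Nat.lt_succ_self i, rfl⟩)

/-! ### Satisfied vertices and blocks -/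

variable {n M K : ℕ} {w : V → Set H.edgeSet → Fin (n + 1)} {W : V → Set H.edgeSet → Finset V}

theorem IsFinitelyDetermined.mono (h : IsFinitelyDetermined w) (a : V) : Monotone (w a) := by
  intro E E' hE
  obtain ⟨F, hF, hfin, hw⟩ := (h E a).1
  exact (h E' a).2 ⟨F, hF.trans hE, hfin, hw⟩

theorem eq_last_of_le {a : V} (h : ∀ a, Monotone (w a)) {E E' : Set H.edgeSet} (hE : E ⊆ E')
    (ha : w a E = Fin.last n) : w a E' = Fin.last n :=
  Fin.last_le_iff.1 (ha ▸ h a hE)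

/-- The property `R_n`: `w` takes its maximal value `n` at every vertex. -/
def AllSat (w : V → Set H.edgeSet → Fin (n + 1)) (E : Set H.edgeSet) : Prop :=
  ∀ a, w a E = Fin.last n

/-- The sets `W a E`, called blocks, and the number `M` witness that `w` is bounded. By `eq_of_mem`
the blocks for a fixed `E` partition the vertices, and `w` is constant on each of them. -/
structure IsBlockSystem (w : V → Set H.edgeSet → Fin (n + 1)) (M : ℕ)
    (W : V → Set H.edgeSet → Finset V) : Prop where
  card_le : ∀ a E, (W a E).card ≤ M
  self_mem : ∀ a E, a ∈ W a E
  eq_of_mem : ∀ a b E, a ∈ W b E → W a E = W b E ∧ w a E = w b E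
  exists_edge : ∀ a E E', E ⊆ E' → w a E < w a E' →
    ∃ e ∈ E' \ E, ∃ x ∈ W a E, x ∈ (e : Sym2 V)

/-- An unsatisfied vertex whose block meets no undetermined pair stays unsatisfied in every
extension. -/
theorem IsBlockSystem.decides (hB : IsBlockSystem w M W) {P : Pregraph H} {a : V}
    (ha : w a P.edges ≠ Fin.last n)
    (hd : ∀ e ∈ P.undetermined, ∀ x ∈ W a P.edges, x ∉ (e : Sym2 V)) :
    P.Decides (AllSat w) := by
  refine Or.inr fun E hE hsat => ?_
  obtain ⟨e, ⟨heE, heP⟩, x, hx, hxe⟩ := hB.exists_edge a P.edges E hE.1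
    (by rw [hsat a]; exact Fin.lt_last_iff_ne_last.2 ha)
  exact hd e (mem_undetermined.2 ⟨heP, fun hn => hE.2 hn heE⟩) x hx hxe

/-- Alice wins if some undetermined pair `e` has only satisfied endpoints: after all other pairs are
determined, `e` meets no block of an unsatisfied vertex, so the answer about `e` is irrelevant. -/
theorem wins_of_sat_edge (hB : IsBlockSystem w M W) (hmono : ∀ a, Monotone (w a))
    {P : Pregraph H} {e : H.edgeSet} (he : e ∈ P.undetermined)
    (hs : ∀ x ∈ (e : Sym2 V), w x P.edges = Fin.last n) : Wins (AllSat w) P := by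
  refine Wins.ask_all (P.undetermined \ {e}) fun Q hQ hdet => ?_
  have hu : Q.undetermined = {e} := by
    rw [undetermined_eq_diff hdet, Set.sdiff_sdiff_cancel_left (Set.singleton_subset_iff.2 he)]
  refine wins_of_decides ?_ (hu ▸ Set.singleton_nonempty e)
  by_cases hall : AllSat w Q.edges
  · exact Or.inl fun E hE a => eq_last_of_le hmono hE.1 (hall a)
  · obtain ⟨a, ha⟩ := not_forall.1 hall
    refine hB.decides ha fun e' he' x hx hxe => ha ?_
    rw [hu, Set.mem_singleton_iff] at he'
    subst he'
    rw [← (hB.eq_of_mem x a _ hx).2]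
    exact eq_last_of_le hmono hQ.1 (hs x hxe)

/-- By the pigeonhole principle, some vertex of `Y` has degree at least `K`. -/
theorem exists_sat_of_card_le
    (hK : ∀ (E : Set H.edgeSet) (a : V), (K : ℕ∞) ≤ degree E a → w a E = Fin.last n)
    {E : Set H.edgeSet} {Y : Finset V} (hY : Y.Nonempty) {F : Finset H.edgeSet}
    (hF : (F : Set H.edgeSet) ⊆ E) (hFY : ∀ e ∈ F, ∃ y ∈ Y, y ∈ (e : Sym2 V))
    (hcard : Y.card * K ≤ F.card) : ∃ y ∈ Y, w y E = Fin.last n := by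
  classical
  have : Nonempty V := ⟨hY.choose⟩
  choose! f hfY hfe using hFY
  obtain ⟨y, hy, hle⟩ := Finset.exists_le_card_fiber_of_mul_le_card_of_maps_to hfY hY hcard
  refine ⟨y, hy, hK E y ?_⟩
  calc (K : ℕ∞) ≤ ((F.filter fun e => f e = y).card : ℕ∞) := by exact_mod_cast hle
    _ = ((F.filter fun e => f e = y : Finset H.edgeSet) : Set H.edgeSet).encard :=
        (Set.encard_coe_eq_coe_finsetCard _).symm
    _ ≤ degree E y := Set.encard_le_encard fun e he => by
        obtain ⟨heF, rfl⟩ := Finset.mem_filter.1 he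
        exact ⟨hF heF, hfe e heF⟩

theorem finite_edges_between (A B : Finset V) :
    {e : H.edgeSet | ∃ a ∈ A, ∃ b ∈ B, (e : Sym2 V) = s(a, b)}.Finite := by
  refine Set.Finite.subset (((A ×ˢ B).finite_toSet.image fun p => s(p.1, p.2)).preimage
    Subtype.val_injective.injOn) ?_
  rintro e ⟨a, ha, b, hb, he⟩
  exact ⟨(a, b), by simp [ha, hb], he.symm⟩

/-! ### Forcing a satisfied vertex in a finite set -/

/-- With infinitely many unsatisfied vertices, Alice either wins or obtains a satisfied vertex of `Y`
by asking about finitely many pairs, none of which has all its endpoints in `Y` or satisfied. The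
finite set `F` collects the positive answers obtained so far, and `k` bounds the number of those
that are still possible. -/
theorem wins_of_infinite_unsat (hB : IsBlockSystem w M W) (hmono : ∀ a, Monotone (w a))
    (hK : ∀ (E : Set H.edgeSet) (a : V), (K : ℕ∞) ≤ degree E a → w a E = Fin.last n)
    {Y : Finset V} (hY : Y.Nonempty) (k : ℕ) : ∀ (P : Pregraph H) (F : Finset H.edgeSet),
    (F : Set H.edgeSet) ⊆ P.edges → (∀ e ∈ F, ∃ y ∈ Y, y ∈ (e : Sym2 V)) →
    Y.card * K ≤ F.card + k →
    (∀ e ∈ P.undetermined, ∃ y ∈ Y, y ∈ (e : Sym2 V)) → P.undetermined.Infinite →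
    {a | w a P.edges ≠ Fin.last n}.Infinite →
    (∀ Q : Pregraph H, Q.Extends P → (P.undetermined \ Q.undetermined).Finite →
      (∀ e ∈ P.undetermined, (∀ x ∈ (e : Sym2 V), x ∈ Y ∨ w x P.edges = Fin.last n) →
        e ∈ Q.undetermined) →
      (∃ y ∈ Y, w y Q.edges = Fin.last n) → Wins (AllSat w) Q) →
    Wins (AllSat w) P := by
  classical
  induction k with
  | zero =>
    intro P F hF hFY hcard _ _ _ h
    exact h P (Extends.refl P) (by simp) (fun e he _ => he)
      (exists_sat_of_card_le hK hY hF hFY hcard)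
  | succ k ih =>
    intro P F hF hFY hcard htouch hinf hunsat h
    obtain ⟨a, ha, haY⟩ := hunsat.exists_notMem_finset (Y.biUnion fun y => W y P.edges)
    -- The block of `a` is disjoint from `Y`, because `a` is in no block of a vertex of `Y`.
    have hdisj : ∀ y ∈ Y, y ∉ W a P.edges := fun y hy hyW => haY <|
      Finset.mem_biUnion.2 ⟨y, hy, (hB.eq_of_mem y a _ hyW).1 ▸ hB.self_mem a _⟩
    set D : Set H.edgeSet := {e ∈ P.undetermined | ∃ x ∈ W a P.edges, x ∈ (e : Sym2 V)}
    have hDeq : ∀ e ∈ D, ∃ y ∈ Y, ∃ x ∈ W a P.edges, (e : Sym2 V) = s(y, x) := by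
      rintro e ⟨he, x, hx, hxe⟩
      obtain ⟨y, hy, hye⟩ := htouch e he
      have hne : y ≠ x := fun h => hdisj y hy (h ▸ hx)
      exact ⟨y, hy, x, hx, (Sym2.mem_and_mem_iff hne).1 ⟨hye, hxe⟩⟩
    have hDfin : D.Finite := (finite_edges_between Y (W a P.edges)).subset hDeq
    refine Wins.ask_all D fun Q hQ hdet => ?_
    have hu := undetermined_eq_diff hdet
    have hQinf : Q.undetermined.Infinite := hu ▸ hinf.sdiff hDfin
    by_cases hyes : ∃ e ∈ D, e ∈ Q.edges
    · obtain ⟨e, heD, heQ⟩ := hyes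
      have heF : e ∉ F := fun heF => (mem_undetermined.1 heD.1).1 (hF heF)
      refine ih Q (insert e F) ?_ ?_ ?_ (fun e he => htouch e (hQ.undetermined_subset he))
        hQinf ?_ fun S hS hfin hkeep hsat => ?_
      · rw [Finset.coe_insert]
        exact Set.insert_subset heQ (hF.trans hQ.1)
      · intro e' he'
        rcases Finset.mem_insert.1 he' with rfl | he'
        · exact htouch e' heD.1
        · exact hFY e' he'
      · rw [Finset.card_insert_of_notMem heF]
        omega
      · -- A newly satisfied vertex is in the block of an endpoint of a new edge, and these endpoints
        -- are in the finite set `Y ∪ W a P.edges`.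
        refine (hunsat.sdiff ((Y ∪ W a P.edges).biUnion fun x => W x P.edges).finite_toSet).mono ?_
        rintro b ⟨hb, hbT⟩ hbQ
        obtain ⟨e', ⟨he'Q, he'P⟩, x, hx, hxe⟩ := hB.exists_edge b P.edges Q.edges hQ.1
          (by rw [hbQ]; exact Fin.lt_last_iff_ne_last.2 hb)
        have he'D : e' ∈ D := (hQ.edges_subset hdet he'Q).resolve_left he'P
        obtain ⟨y, hy, z, hz, heq⟩ := hDeq e' he'D
        refine hbT (Finset.mem_coe.2 (Finset.mem_biUnion.2 ⟨x, ?_, ?_⟩))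
        · rw [heq, Sym2.mem_iff] at hxe
          rcases hxe with rfl | rfl
          · exact Finset.mem_union_left _ hy
          · exact Finset.mem_union_right _ hz
        · exact (hB.eq_of_mem x b _ hx).1 ▸ hB.self_mem b _
      · refine h S (hS.trans hQ) ((hDfin.union hfin).subset ?_) (fun e he hx => ?_) hsat
        · rintro e ⟨he, heS⟩
          by_cases heD : e ∈ D
          · exact Or.inl heD
          · exact Or.inr ⟨hu ▸ ⟨he, heD⟩, heS⟩
        · refine hkeep e (hu ▸ ⟨he, ?_⟩) fun x hxe => (hx x hxe).imp_right (eq_last_of_le hmono hQ.1)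
          rintro ⟨-, x, hxW, hxe⟩
          rcases hx x hxe with hxY | hxs
          · exact hdisj x hxY hxW
          · exact ha ((hB.eq_of_mem x a _ hxW).2 ▸ hxs)
    · -- Without a positive answer the block of `a` is closed off while pairs are still alive.
      have hE : Q.edges = P.edges := Set.Subset.antisymm
        (fun e he => (hQ.edges_subset hdet he).resolve_right fun heD => hyes ⟨e, heD, he⟩) hQ.1
      refine wins_of_decides (hB.decides (a := a) (hE ▸ ha) ?_) hQinf.nonempty
      intro e he x hx hxe
      rw [hu] at he
      exact he.2 ⟨he.1, x, hE ▸ hx, hxe⟩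

/-- Alice wins if there are countably many undetermined pairs, each of them joins a vertex of `Y` to a
satisfied vertex outside `Y`, and each vertex of `Y` is in infinitely many of them. As before, `F`
collects the positive answers and `k` bounds the number of those still possible. -/
theorem wins_of_countable_stars (hB : IsBlockSystem w M W) (hmono : ∀ a, Monotone (w a))
    (hK : ∀ (E : Set H.edgeSet) (a : V), (K : ℕ∞) ≤ degree E a → w a E = Fin.last n)
    {Y : Finset V} (hY : M < Y.card) (k : ℕ) : ∀ (P : Pregraph H) (F : Finset H.edgeSet),
    (F : Set H.edgeSet) ⊆ P.edges → (∀ e ∈ F, ∃ y ∈ Y, y ∈ (e : Sym2 V)) →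
    Y.card * K ≤ F.card + k → P.undetermined.Countable →
    (∀ e ∈ P.undetermined, ∃ y ∈ Y, y ∈ (e : Sym2 V) ∧
      ∀ x ∈ (e : Sym2 V), x ≠ y → x ∉ Y ∧ w x P.edges = Fin.last n) →
    (∀ y ∈ Y, {e ∈ P.undetermined | y ∈ (e : Sym2 V)}.Infinite) →
    Wins (AllSat w) P := by
  classical
  have hYne : Y.Nonempty := Finset.card_pos.1 (by omega)
  -- Once some `y ∈ Y` is satisfied, every undetermined pair at `y` has only satisfied endpoints.
  have hwin : ∀ P : Pregraph H, (∀ e ∈ P.undetermined, ∃ y ∈ Y, y ∈ (e : Sym2 V) ∧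
      ∀ x ∈ (e : Sym2 V), x ≠ y → x ∉ Y ∧ w x P.edges = Fin.last n) →
      (∀ y ∈ Y, {e ∈ P.undetermined | y ∈ (e : Sym2 V)}.Infinite) →
      (∃ y ∈ Y, w y P.edges = Fin.last n) → Wins (AllSat w) P := by
    rintro P hends hstar ⟨y, hy, hys⟩
    obtain ⟨e, he, hye⟩ := (hstar y hy).nonempty
    refine wins_of_sat_edge hB hmono he fun x hxe => ?_
    obtain ⟨y', -, -, hx⟩ := hends e he
    have hyy : y = y' := by
      by_contra hne
      exact (hx y hye hne).1 hy
    by_cases hxy : x = y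
    · exact hxy ▸ hys
    · exact (hx x hxe (hyy ▸ hxy)).2
  induction k with
  | zero =>
    intro P F hF hFY hcard _ hends hstar
    exact hwin P hends hstar (exists_sat_of_card_le hK hYne hF hFY hcard)
  | succ k ih =>
    intro P F hF hFY hcard hcount hends hstar
    by_cases hsat : ∃ y ∈ Y, w y P.edges = Fin.last n
    · exact hwin P hends hstar hsat
    obtain ⟨y₀, hy₀⟩ := hYne
    have hy₀s : w y₀ P.edges ≠ Fin.last n := fun h => hsat ⟨y₀, hy₀, h⟩
    obtain ⟨y₁, hy₁, hy₁W⟩ : ∃ y₁ ∈ Y, y₁ ∉ W y₀ P.edges :=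
      Finset.exists_mem_notMem_of_card_lt_card ((hB.card_le y₀ P.edges).trans_lt hY)
    set U : Set H.edgeSet := {e ∈ P.undetermined | ∃ x ∈ W y₀ P.edges, x ∈ (e : Sym2 V)}
    have hUinf : U.Infinite := (hstar y₀ hy₀).mono fun e he => ⟨he.1, y₀, hB.self_mem _ _, he.2⟩
    have hUc : U.Countable := hcount.mono fun e he => he.1
    have := hUinf.to_subtype
    have := hUc.to_subtype
    obtain ⟨d⟩ := nonempty_denumerable U
    let f : ℕ → H.edgeSet := fun i => ((Denumerable.eqv U).symm i : U)
    have hf : Function.Injective f :=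
      Subtype.val_injective.comp (Denumerable.eqv U).symm.injective
    have hfU : ∀ i, f i ∈ U := fun i => Subtype.coe_prop _
    have hrange : ∀ e ∈ U, e ∈ Set.range f := fun e he =>
      ⟨Denumerable.eqv U ⟨e, he⟩, by simp [f]⟩
    refine Wins.ask_until_yes f hf (fun i => (hfU i).1) (fun i Q hE hN => ?_) fun Q hE hN => ?_
    · have hQ : Q.Extends P := ⟨hE ▸ Set.subset_insert _ _, hN ▸ Set.subset_union_left⟩
      have hu : P.undetermined \ f '' Set.Iic i ⊆ Q.undetermined := by
        rintro e ⟨he, hne⟩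
        rw [mem_undetermined] at he ⊢
        rw [hE, hN]
        refine ⟨?_, ?_⟩
        · rintro (rfl | h)
          · exact hne ⟨i, Set.mem_Iic.2 le_rfl, rfl⟩
          · exact he.1 h
        · rintro (h | h)
          · exact he.2 h
          · exact hne (Set.image_mono Set.Iio_subset_Iic_self h)
      have hiF : f i ∉ F := fun h => (mem_undetermined.1 (hfU i).1).1 (hF h)
      refine ih Q (insert (f i) F) ?_ ?_ ?_ (hcount.mono hQ.undetermined_subset) ?_ ?_
      · rw [Finset.coe_insert, hE]
        exact Set.insert_subset_insert hF
      · intro e he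
        rcases Finset.mem_insert.1 he with rfl | he
        · obtain ⟨y, hy, hye, -⟩ := hends _ (hfU i).1
          exact ⟨y, hy, hye⟩
        · exact hFY e he
      · rw [Finset.card_insert_of_notMem hiF]
        omega
      · intro e he
        obtain ⟨y, hy, hye, hx⟩ := hends e (hQ.undetermined_subset he)
        exact ⟨y, hy, hye, fun x hxe hxy =>
          (hx x hxe hxy).imp_right (eq_last_of_le hmono hQ.1)⟩
      · intro y hy
        refine ((hstar y hy).sdiff ((Set.finite_Iic i).image f)).mono ?_
        rintro e ⟨⟨he, hye⟩, hne⟩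
        exact ⟨hu ⟨he, hne⟩, hye⟩
    · -- All answers were negative: the block of `y₀` is closed off, and the pairs at `y₁` are alive,
      -- since their other endpoints are satisfied and hence not in the block of `y₀` either.
      refine wins_of_decides (hB.decides (a := y₀) (hE ▸ hy₀s) ?_) ?_
      · intro e he x hx hxe
        rw [mem_undetermined, hE, hN] at he
        rw [hE] at hx
        exact he.2 (Or.inr (hrange e ⟨mem_undetermined.2 ⟨he.1, fun h => he.2 (Or.inl h)⟩,
          x, hx, hxe⟩))
      · obtain ⟨e, he, hye⟩ := (hstar y₁ hy₁).nonempty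
        refine ⟨e, ?_⟩
        have he' := mem_undetermined.1 he
        rw [mem_undetermined, hE, hN]
        refine ⟨he'.1, ?_⟩
        rintro (h | ⟨i, rfl⟩)
        · exact he'.2 h
        obtain ⟨-, x, hxW, hxe⟩ := hfU i
        obtain ⟨y, -, -, hx⟩ := hends _ he
        have hyy : y₁ = y := by
          by_contra hne
          exact (hx y₁ hye hne).1 hy₁
        have hxy : x ≠ y := by
          rintro rfl
          exact hy₁W (hyy ▸ hxW)
        exact hy₀s ((hB.eq_of_mem x y₀ _ hxW).2 ▸ (hx x hxe hxy).2)

/-- If all undetermined pairs meet `Y`, `|Y| > M`, and each vertex of `Y` is in infinitely many of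
them, then Alice either wins or obtains a satisfied vertex of `Y` by asking about finitely many
pairs, none of which has all its endpoints in `Y` or satisfied. -/
theorem wins_of_infinite_stars (hB : IsBlockSystem w M W) (hmono : ∀ a, Monotone (w a))
    (hK : ∀ (E : Set H.edgeSet) (a : V), (K : ℕ∞) ≤ degree E a → w a E = Fin.last n)
    {Y : Finset V} (hY : M < Y.card) {P : Pregraph H}
    (htouch : ∀ e ∈ P.undetermined, ∃ y ∈ Y, y ∈ (e : Sym2 V))
    (hstar : ∀ y ∈ Y, {e ∈ P.undetermined | y ∈ (e : Sym2 V)}.Infinite)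
    (h : ∀ Q : Pregraph H, Q.Extends P → (P.undetermined \ Q.undetermined).Finite →
      (∀ e ∈ P.undetermined, (∀ x ∈ (e : Sym2 V), x ∈ Y ∨ w x P.edges = Fin.last n) →
        e ∈ Q.undetermined) →
      (∃ y ∈ Y, w y Q.edges = Fin.last n) → Wins (AllSat w) Q) :
    Wins (AllSat w) P := by
  classical
  have hYne : Y.Nonempty := Finset.card_pos.1 (by omega)
  by_cases hunsat : {a | w a P.edges ≠ Fin.last n}.Infinite
  · obtain ⟨y, hy⟩ := hYne
    exact wins_of_infinite_unsat hB hmono hK ⟨y, hy⟩ (Y.card * K) P ∅ (by simp) (by simp)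
      (by simp) htouch ((hstar y hy).mono fun e he => he.1) hunsat h
  · rw [Set.not_infinite] at hunsat
    -- Discarding the finitely many pairs at `y` that end in `Y` or in an unsatisfied vertex, a
    -- countable part of the star of `y` is kept.
    have hthin : ∀ y ∈ Y, ∃ T : Set H.edgeSet, T.Infinite ∧ T.Countable ∧
        ∀ e ∈ T, e ∈ P.undetermined ∧ y ∈ (e : Sym2 V) ∧
          ∀ x ∈ (e : Sym2 V), x ≠ y → x ∉ Y ∧ w x P.edges = Fin.last n := by
      intro y hy
      have hinf := (hstar y hy).sdiff (finite_edges_between {y} (Y ∪ hunsat.toFinset))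
      refine ⟨Set.range fun i => (hinf.natEmbedding _ i : H.edgeSet),
        Set.infinite_range_of_injective
          (Subtype.val_injective.comp (hinf.natEmbedding _).injective),
        Set.countable_range _, ?_⟩
      rintro _ ⟨i, rfl⟩
      obtain ⟨⟨he, hye⟩, hne⟩ := (hinf.natEmbedding _ i).2
      refine ⟨he, hye, fun x hxe hxy => ?_⟩
      have hx : x ∉ Y ∪ hunsat.toFinset := fun hx => hne
        ⟨y, Finset.mem_singleton_self y, x, hx, (Sym2.mem_and_mem_iff hxy.symm).1 ⟨hye, hxe⟩⟩
      simpa [not_or] using hx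
    choose! T hTinf hTc hT using hthin
    refine Wins.ask_all (P.undetermined \ ⋃ y ∈ Y, T y) fun Q hQ hdet => ?_
    have hu : Q.undetermined = ⋃ y ∈ Y, T y := by
      rw [undetermined_eq_diff hdet, Set.sdiff_sdiff_cancel_left]
      exact Set.iUnion₂_subset fun y hy e he => (hT y hy e he).1
    refine wins_of_countable_stars hB hmono hK hY (Y.card * K) Q ∅ (by simp) (by simp) (by simp)
      ?_ ?_ ?_
    · rw [hu]
      exact Y.countable_toSet.biUnion hTc
    · intro e he
      rw [hu] at he
      obtain ⟨y, hy, he⟩ := Set.mem_iUnion₂.1 he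
      obtain ⟨-, hye, hx⟩ := hT y hy e he
      exact ⟨y, hy, hye, fun x hxe hxy => (hx x hxe hxy).imp_right (eq_last_of_le hmono hQ.1)⟩
    · intro y hy
      refine (hTinf y hy).mono fun e he => ⟨?_, (hT y hy e he).2.1⟩
      rw [hu]
      exact Set.mem_biUnion hy he

/-! ### Braided graphs -/

/-- Some finite `Y` contains at least `m - 1` neighbours of every vertex: it is the union of `m`
disjoint covering sets, and a vertex is in at most one of these. The sharper bound for vertices
outside `Y` is what makes the induction work. -/
theorem IsBraided.exists_finset [Infinite V] (hH : IsBraided H) (m : ℕ) :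
    ∃ Y : Finset V, ∀ v, ∃ s ⊆ Y, (∀ x ∈ s, H.Adj v x) ∧ m ≤ s.card + 1 ∧
      (v ∉ Y → m ≤ s.card) := by
  classical
  induction m with
  | zero => exact ⟨∅, fun v => ⟨∅, by simp⟩⟩
  | succ m ih =>
    obtain ⟨Y, hY⟩ := ih
    obtain ⟨L, hLfin, hLY, hL⟩ := hH Y ((Cardinal.lt_aleph0_of_finite _).trans_le
      (Cardinal.aleph0_le_mk V))
    lift L to Finset V using hLfin
    refine ⟨Y ∪ L, fun v => ?_⟩
    obtain ⟨s, hsY, hadj, h1, h2⟩ := hY v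
    by_cases hvL : v ∈ L
    · refine ⟨s, hsY.trans Finset.subset_union_left, hadj, ?_, ?_⟩
      · have := h2 fun hvY => hLY hvL hvY
        omega
      · exact fun h => absurd (Finset.mem_union_right _ hvL) h
    · obtain ⟨a, haL, ha⟩ := hL v hvL
      have has : a ∉ s := fun h => hLY haL (hsY h)
      refine ⟨insert a s, ?_, ?_, ?_, ?_⟩
      · exact Finset.insert_subset (Finset.mem_union_right _ haL)
          (hsY.trans Finset.subset_union_left)
      · intro x hx
        rcases Finset.mem_insert.1 hx with rfl | hx
        · exact ha
        · exact hadj x hx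
      · rw [Finset.card_insert_of_notMem has]
        omega
      · intro hv
        have := h2 fun h => hv (Finset.mem_union_left _ h)
        rw [Finset.card_insert_of_notMem has]
        omega

theorem IsBraided.infinite_star [Infinite V] (hH : IsBraided H) (v : V) :
    {e : H.edgeSet | v ∈ (e : Sym2 V)}.Infinite := by
  have hnbr : {u | H.Adj v u}.Infinite := by
    intro hfin
    obtain ⟨Y, hY⟩ := hH.exists_finset (hfin.toFinset.card + 2)
    obtain ⟨s, -, hadj, hcard, -⟩ := hY v
    have := Finset.card_le_card (s := s) (t := hfin.toFinset) fun x hx => by simpa using hadj x hx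
    omega
  have := hnbr.to_subtype
  refine (Set.infinite_range_of_injective
    (f := fun u : {u | H.Adj v u} => (⟨s(v, u), u.2⟩ : H.edgeSet)) ?_).mono ?_
  · intro a b hab
    exact Subtype.ext (Sym2.congr_right.1 (congrArg Subtype.val hab))
  · rintro _ ⟨u, rfl⟩
    exact Sym2.mem_mk_left v u

/-- Alice wins from the empty position. -/
theorem wins_of_isBraided [Infinite V] (hH : IsBraided H) (hB : IsBlockSystem w M W)
    (hmono : ∀ a, Monotone (w a))
    (hK : ∀ (E : Set H.edgeSet) (a : V), (K : ℕ∞) ≤ degree E a → w a E = Fin.last n) :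
    Wins (AllSat w) (⟨∅, ∅, Set.disjoint_empty _⟩ : Pregraph H) := by
  obtain ⟨Y, hY⟩ := hH.exists_finset (M + 2)
  have hYcard : M < Y.card := by
    obtain ⟨v⟩ : Nonempty V := inferInstance
    obtain ⟨s, hsY, -, hs, -⟩ := hY v
    have := Finset.card_le_card hsY
    omega
  refine Wins.ask_all {e : H.edgeSet | ∃ y ∈ Y, y ∈ (e : Sym2 V)}ᶜ fun P _ hP => ?_
  have hu : P.undetermined = {e : H.edgeSet | ∃ y ∈ Y, y ∈ (e : Sym2 V)} := by
    rw [undetermined_eq_diff hP]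
    simp [undetermined, determined]
  refine wins_of_infinite_stars hB hmono hK hYcard (fun e he => hu.subset he) (fun y hy => ?_)
    fun Q hQ hfin hkeep ⟨z, hz, hzs⟩ => ?_
  · refine (hH.infinite_star y).mono fun e he => ⟨hu.superset ⟨y, hy, he⟩, he⟩
  -- `Y'` consists of neighbours of `z`; as `z` is satisfied, a satisfied vertex of `Y'` yields a pair
  -- with both ends satisfied. Such pairs are kept, as their ends are in `Y`, and later in `Y'` or `z`.
  obtain ⟨Y', hY', hadj, hcard, -⟩ := hY z
  refine Wins.ask_all {e : H.edgeSet | ∃ y ∈ Y', y ∈ (e : Sym2 V)}ᶜ fun P' hP' hdet' => ?_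
  have hu' : P'.undetermined = Q.undetermined ∩ {e : H.edgeSet | ∃ y ∈ Y', y ∈ (e : Sym2 V)} := by
    rw [undetermined_eq_diff hdet', Set.sdiff_compl]
  refine wins_of_infinite_stars (Y := Y') hB hmono hK (by omega) (fun e he => (hu'.subset he).2)
    (fun y hy => ?_) fun S hS _ hkeep' ⟨y, hy, hys⟩ => ?_
  · refine ((hH.infinite_star y).sdiff hfin).mono ?_
    rintro e ⟨hye, hne⟩
    refine ⟨hu'.superset ⟨?_, y, hy, hye⟩, hye⟩
    by_contra heQ
    exact hne ⟨hu.superset ⟨y, hY' hy, hye⟩, heQ⟩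
  · refine wins_of_sat_edge (e := ⟨s(z, y), hadj y hy⟩) hB hmono ?_ ?_
    · refine hkeep' _ (hu'.superset ⟨hkeep _ (hu.superset ⟨z, hz, by simp⟩) ?_, y, hy, by simp⟩) ?_
      · intro x hx
        rcases Sym2.mem_iff.1 hx with rfl | rfl
        · exact Or.inl hz
        · exact Or.inl (hY' hy)
      · intro x hx
        rcases Sym2.mem_iff.1 hx with rfl | rfl
        · exact Or.inr (eq_last_of_le hmono hP'.1 hzs)
        · exact Or.inl hy
    · intro x hx
      rcases Sym2.mem_iff.1 hx with rfl | rfl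
      · exact eq_last_of_le hmono (hP'.1.trans hS.1) hzs
      · exact hys

end EdgeGame

theorem mainTheorem2 {V : Type u} [Infinite V] (H : SimpleGraph V) (hH : EdgeGame.IsBraided H)
    (n : ℕ) (w : V → Set H.edgeSet → Fin (n + 1))
    (hw_nontrivial : EdgeGame.IsNontrivial w)
    (hw_degree : EdgeGame.IsDegreeRestricted w)
    (hw_finite : EdgeGame.IsFinitelyDetermined w)
    (hw_bounded : EdgeGame.IsBounded w) :
    Monotone (fun E : Set H.edgeSet => ∀ a, w a E = Fin.last n) ∧
      ¬ EdgeGame.IsElusive H (fun E : Set H.edgeSet => ∀ a, w a E = Fin.last n) := by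
  obtain ⟨K, hK⟩ := hw_degree
  obtain ⟨M, W, h₁, h₂, h₃, h₄⟩ := hw_bounded
  refine ⟨fun E E' hE h a => EdgeGame.eq_last_of_le hw_finite.mono hE (h a), ?_⟩
  exact EdgeGame.not_isElusive_of_wins rfl rfl
    (EdgeGame.wins_of_isBraided hH ⟨h₁, h₂, h₃, h₄⟩ hw_finite.mono hK)
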